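/- Let $S$ be a Polish space with its Borel $\sigma$-algebra. A function $V:S\times S\to[0,\infty)$ is called a divergence function if it is lower semicontinuous and satisfies (i) (positive definiteness) $V(s_1,s_2)=0$ if and only if $s_1=s_2$; (ii) (symmetry) $V(s_1,s_2)=V(s_2,s_1)$ for all $s_1,s_2\in S$; (iii) (inf-compactness) for every $q\ge 0$ and every compact $K\subset S$ there is a compact $L\subset S$ with $\inf_{(s_1,s_2)\in L^{c}\times K}V(s_1,s_2)\ge q$, where $\inf\emptyset=\infty$. For measures $\mu_1,\mu_2$ on $S$ let $C(\mu_1,\mu_2)$ be the set of probability measures $\xi$ on $S\times S$ with $\xi(B\times S)=\mu_1(B)$ and $\xi(S\times B)=\mu_2(B)$ for all Borel sets $B\subset S$, and let $$W_V(\mu_1,\mu_2)=\inf_{\xi\in C(\mu_1,\mu_2)}\int_{S\times S}V\,d\xi\in[0,\infty],\qquad \inf\emptyset=\infty .$$ **Theorem.** Let $V$ be a divergence function on $S$, let $(\mu_k)_{k\in\mathbb N}$ be a sequence of probability measures on $S$, and let $\theta$ be a measure on $S$ (not assumed to be a probability measure) such that $\limsup_{k\to\infty}W_V(\mu_k,\theta)=0$.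 Then $\theta$ is a probability measure, and $\mu_k\to\theta$ in the weak* topology, that is, $\int f\,d\mu_k\to\int f\,d\theta$ for every bounded continuous $f:S\to\mathbb R$. Inf-compactness cannot be dropped: on $S=\mathbb R$ the function $V(s_1,s_2)=|s_1-s_2|\,e^{-|s_1-s_2|}$ is lower semicontinuous and satisfies (i) and (ii) but not (iii), and the unit point masses $\delta_k$, $k\in\mathbb N$, satisfy $W_V(\delta_k,\delta_0)=k e^{-k}$ for every $k$, so that $\limsup_{k\to\infty} W_V(\delta_k,\delta_0)=0$, although $(\delta_k)$ converges to no probability measure in the weak* topology. -/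

import Mathlib

open MeasureTheory Filter Topology Set
open scoped NNReal ENNReal

/-- Inf-compactness of `V : S × S → [0, ∞)`: for every `q ≥ 0` and every compact `K` there is a
compact `L` with `inf {V (s₁, s₂) : s₁ ∉ L, s₂ ∈ K} ≥ q`. The infimum is taken in `[0, ∞]`, so
the infimum over the empty set is `∞`. -/
def InfCompact {S : Type*} [TopologicalSpace S] (V : S → S → ℝ≥0) : Prop :=
  ∀ (q : ℝ≥0) (K : Set S), IsCompact K →
    ∃ L : Set S, IsCompact L ∧ (q : ℝ≥0∞) ≤ ⨅ p ∈ Lᶜ ×ˢ K, (V p.1 p.2 : ℝ≥0∞)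

/-- The requirements on a divergence function other than inf-compactness: joint lower
semicontinuity, positive definiteness and symmetry. -/
structure IsPreDivergence {S : Type*} [TopologicalSpace S] (V : S → S → ℝ≥0) : Prop where
  lowerSemicontinuous : LowerSemicontinuous (fun p : S × S => V p.1 p.2)
  eq_zero_iff : ∀ s₁ s₂ : S, V s₁ s₂ = 0 ↔ s₁ = s₂
  symm : ∀ s₁ s₂ : S, V s₁ s₂ = V s₂ s₁

/-- Divergence functions. -/
structure IsDivergence {S : Type*} [TopologicalSpace S] (V : S → S → ℝ≥0) : Prop
    extends IsPreDivergence V where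
  infCompact : InfCompact V

/-- The couplings of two measures: the probability measures on `S × S` whose marginals are `μ₁`
and `μ₂`. -/
def couplings {S : Type*} [MeasurableSpace S] (μ₁ μ₂ : Measure S) : Set (Measure (S × S)) :=
  {ξ | IsProbabilityMeasure ξ ∧ ∀ B : Set S, MeasurableSet B →
    ξ (B ×ˢ univ) = μ₁ B ∧ ξ (univ ×ˢ B) = μ₂ B}

/-- The Wasserstein divergence, with values in `[0, ∞]`; it is `∞` if there is no coupling. -/
noncomputable def wassersteinDiv {S : Type*} [MeasurableSpace S] (V : S → S → ℝ≥0)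
    (μ₁ μ₂ : Measure S) : ℝ≥0∞ :=
  ⨅ ξ ∈ couplings μ₁ μ₂, ∫⁻ p, (V p.1 p.2 : ℝ≥0∞) ∂ξ

/-- The function `|s₁ - s₂| exp (-|s₁ - s₂|)` on `ℝ × ℝ`. -/
noncomputable def expDiv (s₁ s₂ : ℝ) : ℝ≥0 :=
  ⟨|s₁ - s₂| * Real.exp (-|s₁ - s₂|), by positivity⟩

/-- The unit mass at a real number, as a probability measure. -/
noncomputable def pointMass (x : ℝ) : ProbabilityMeasure ℝ :=
  ⟨Measure.dirac x, inferInstance⟩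

/-! By the portmanteau theorem it suffices that `θ G ≤ liminf μ k G` for open `G`, and inner
regularity replaces `θ G` by `θ K` with `K ⊆ G` compact. A coupling must put mass at least `θ K - μ
k G` on `Gᶜ ×ˢ K`. There `V ≥ δ > 0`: inf-compactness handles points outside a compact `L`, lower
semicontinuity and definiteness the rest. Hence `θ K ≤ μ k G + δ⁻¹ W`, with `W → 0`. In the
counterexample `V` decays at infinity, so mass escapes at vanishing cost. -/

/-- A divergence function is bounded away from zero on the product of a closed set and a compact
set that are disjoint. -/
theorem IsDivergence.exists_pos_forall_le {S : Type*} [TopologicalSpace S] [T2Space S]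
    {V : S → S → ℝ≥0} (hV : IsDivergence V) {F K : Set S} (hF : IsClosed F) (hK : IsCompact K)
    (hFK : Disjoint F K) : ∃ δ : ℝ≥0, 0 < δ ∧ ∀ x ∈ F, ∀ y ∈ K, δ ≤ V x y := by
  obtain ⟨L, hL, hLK⟩ := hV.infCompact 1 K hK
  have hout : ∀ x ∉ L, ∀ y ∈ K, 1 ≤ V x y := fun x hx y hy => by
    have h := hLK.trans (iInf₂_le (x, y) (mk_mem_prod hx hy))
    exact_mod_cast h
  rcases ((L ∩ F) ×ˢ K).eq_empty_or_nonempty with he | hne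
  · refine ⟨1, one_pos, fun x hx y hy => hout x (fun hxL => ?_) y hy⟩
    have : (x, y) ∈ (L ∩ F) ×ˢ K := ⟨⟨hxL, hx⟩, hy⟩
    simp [he] at this
  · obtain ⟨p, hp, hmin⟩ := (hV.lowerSemicontinuous.lowerSemicontinuousOn _).exists_isMinOn hne
      ((hL.inter_right hF).prod hK)
    have hpos : 0 < V p.1 p.2 := by
      refine pos_iff_ne_zero.2 fun h => ?_
      have hpp := (hV.eq_zero_iff _ _).1 h
      exact hFK.ne_of_mem hp.1.2 hp.2 hpp
    refine ⟨min 1 (V p.1 p.2), lt_min one_pos hpos, fun x hx y hy => ?_⟩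
    by_cases hxL : x ∈ L
    · exact (min_le_right _ _).trans (hmin (mk_mem_prod ⟨hxL, hx⟩ hy))
    · exact (min_le_left _ _).trans (hout x hxL y hy)

/-- The second marginal of a coupling is a probability measure. -/
theorem isProbabilityMeasure_of_mem_couplings {S : Type*} [MeasurableSpace S]
    {μ θ : Measure S} {ξ : Measure (S × S)} (hξ : ξ ∈ couplings μ θ) :
    IsProbabilityMeasure θ := by
  obtain ⟨h1, h⟩ := hξ
  exact ⟨by rw [← (h univ .univ).2, univ_prod_univ, measure_univ]⟩

/-- If the Wasserstein divergence is finite, there is a coupling. -/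
theorem couplings_nonempty_of_wassersteinDiv_ne_top {S : Type*} [MeasurableSpace S]
    {V : S → S → ℝ≥0} {μ θ : Measure S} (h : wassersteinDiv V μ θ ≠ ∞) :
    (couplings μ θ).Nonempty := by
  by_contra he
  rw [not_nonempty_iff_eq_empty] at he
  simp [wassersteinDiv, he] at h

/-- Markov's inequality for the Wasserstein divergence. -/
theorem measure_le_add_wassersteinDiv_div {S : Type*} [MeasurableSpace S] {V : S → S → ℝ≥0}
    {μ θ : Measure S} {G K : Set S} (hG : MeasurableSet G) (hK : MeasurableSet K) {δ : ℝ≥0}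
    (hδ : 0 < δ) (h : ∀ x ∈ Gᶜ, ∀ y ∈ K, δ ≤ V x y) :
    θ K ≤ μ G + (δ : ℝ≥0∞)⁻¹ * wassersteinDiv V μ θ := by
  have hδ0 : (δ : ℝ≥0∞) ≠ 0 := by simpa using hδ.ne'
  have key : ∀ ξ ∈ couplings μ θ,
      δ * (θ K - μ G) ≤ ∫⁻ p, (V p.1 p.2 : ℝ≥0∞) ∂ξ := fun ξ hξ => by
    -- The subtraction is truncated; the bound comes from `univ ×ˢ K ⊆ G ×ˢ univ ∪ Gᶜ ×ˢ K`.
    have hsub : θ K - μ G ≤ ξ (Gᶜ ×ˢ K) := by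
      rw [tsub_le_iff_left, ← (hξ.2 G hG).1, ← (hξ.2 K hK).2]
      refine (measure_mono fun p hp => ?_).trans (measure_union_le _ _)
      by_cases hpG : p.1 ∈ G
      · exact Or.inl ⟨hpG, trivial⟩
      · exact Or.inr ⟨hpG, hp.2⟩
    calc δ * (θ K - μ G) ≤ δ * ξ (Gᶜ ×ˢ K) := by gcongr
      _ = ∫⁻ _ in Gᶜ ×ˢ K, (δ : ℝ≥0∞) ∂ξ := (setLIntegral_const _ _).symm
      _ ≤ ∫⁻ p in Gᶜ ×ˢ K, (V p.1 p.2 : ℝ≥0∞) ∂ξ :=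
          setLIntegral_mono' (hG.compl.prod hK) fun p hp =>
            ENNReal.coe_le_coe.2 (h p.1 hp.1 p.2 hp.2)
      _ ≤ ∫⁻ p, (V p.1 p.2 : ℝ≥0∞) ∂ξ := setLIntegral_le_lintegral _ _
  rw [← tsub_le_iff_left, ← ENNReal.div_eq_inv_mul,
    ENNReal.le_div_iff_mul_le (Or.inl hδ0) (Or.inl ENNReal.coe_ne_top), mul_comm]
  exact le_iInf₂ key

theorem tendsto_zero_of_limsup_eq_zero {u : ℕ → ℝ≥0∞} (h : limsup u atTop = 0) :
    Tendsto u atTop (𝓝 0) :=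
  tendsto_of_le_liminf_of_limsup_le zero_le h.le

/-- Convergence in the Wasserstein divergence implies weak convergence. -/
theorem IsDivergence.exists_tendsto_of_tendsto_wassersteinDiv {S : Type*} [TopologicalSpace S]
    [PolishSpace S] [MeasurableSpace S] [BorelSpace S] {V : S → S → ℝ≥0} (hV : IsDivergence V)
    {μ : ℕ → ProbabilityMeasure S} {θ : Measure S}
    (h : Tendsto (fun k => wassersteinDiv V (μ k : Measure S) θ) atTop (𝓝 0)) :
    ∃ hθ : IsProbabilityMeasure θ,
      Tendsto μ atTop (𝓝 (⟨θ, hθ⟩ : ProbabilityMeasure S)) := by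
  obtain ⟨k, hk⟩ := (h.eventually_lt_const ENNReal.zero_lt_top).exists
  obtain ⟨ξ, hξ⟩ := couplings_nonempty_of_wassersteinDiv_ne_top hk.ne
  have hθ : IsProbabilityMeasure θ := isProbabilityMeasure_of_mem_couplings hξ
  refine ⟨hθ, tendsto_of_forall_isOpen_le_liminf' fun G hG => le_of_forall_lt fun r hr => ?_⟩
  obtain ⟨K, hKG, hK, hrK⟩ := hG.measurableSet.exists_lt_isCompact (μ := θ) hr
  obtain ⟨δ, hδ, hle⟩ := hV.exists_pos_forall_le hG.isClosed_compl hK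
    (disjoint_compl_left_iff_subset.2 hKG)
  have h0 : Tendsto (fun k => (δ : ℝ≥0∞)⁻¹ * wassersteinDiv V (μ k : Measure S) θ) atTop
      (𝓝 0) := by
    simpa using ENNReal.Tendsto.const_mul h (Or.inr (by simpa using hδ.ne'))
  refine hrK.trans_le ?_
  -- Adding a null sequence leaves the liminf unchanged.
  rw [← ENNReal.liminf_add_of_right_tendsto_zero h0]
  exact le_liminf_of_le (by isBoundedDefault) (Eventually.of_forall fun k =>
    measure_le_add_wassersteinDiv_div hG.measurableSet hK.measurableSet hδ hle)

/-- The Wasserstein divergence of two unit masses is the divergence of their points. -/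
theorem wassersteinDiv_dirac_dirac {S : Type*} [MeasurableSpace S] [MeasurableSingletonClass S]
    (V : S → S → ℝ≥0) (a b : S) :
    wassersteinDiv V (Measure.dirac a) (Measure.dirac b) = V a b := by
  refine le_antisymm ?_ (le_iInf₂ fun ξ hξ => ?_)
  · have hmem : Measure.dirac (a, b) ∈ couplings (Measure.dirac a) (Measure.dirac b) := by
      refine ⟨inferInstance, fun B hB => ⟨?_, ?_⟩⟩
      · rw [Measure.dirac_apply' _ (hB.prod .univ), Measure.dirac_apply' _ hB]
        by_cases ha : a ∈ B <;> simp [ha]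
      · rw [Measure.dirac_apply' _ (MeasurableSet.univ.prod hB), Measure.dirac_apply' _ hB]
        by_cases hb : b ∈ B <;> simp [hb]
    exact (iInf₂_le _ hmem).trans_eq (lintegral_dirac _ _)
  -- The marginals force every coupling to be concentrated at `(a, b)`.
  · have := hξ.1
    have ha : ∀ᵐ p ∂ξ, p.1 = a := by
      rw [ae_iff]
      convert (hξ.2 {a}ᶜ (measurableSet_singleton a).compl).1 using 1
      · congr 1
        ext p
        simp
      · simp
    have hb : ∀ᵐ p ∂ξ, p.2 = b := by
      rw [ae_iff]
      convert (hξ.2 {b}ᶜ (measurableSet_singleton b).compl).2 using 1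
      · congr 1
        ext p
        simp
      · simp
    have hab : ∫⁻ p, (V p.1 p.2 : ℝ≥0∞) ∂ξ = ∫⁻ _, (V a b : ℝ≥0∞) ∂ξ :=
      lintegral_congr_ae (by filter_upwards [ha, hb] with p h1 h2; rw [h1, h2])
    rw [hab, lintegral_const, measure_univ, mul_one]

theorem coe_expDiv (s₁ s₂ : ℝ) :
    (expDiv s₁ s₂ : ℝ) = |s₁ - s₂| * Real.exp (-|s₁ - s₂|) := rfl

theorem isPreDivergence_expDiv : IsPreDivergence expDiv where
  lowerSemicontinuous := by
    have h : Continuous fun p : ℝ × ℝ => expDiv p.1 p.2 := by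
      refine NNReal.isEmbedding_coe.continuous_iff.2 ?_
      change Continuous fun p : ℝ × ℝ => (expDiv p.1 p.2 : ℝ)
      simp only [coe_expDiv]
      fun_prop
    exact h.lowerSemicontinuous
  eq_zero_iff s₁ s₂ := by
    rw [← NNReal.coe_eq_zero, coe_expDiv]
    simp [sub_eq_zero]
  symm s₁ s₂ := by
    rw [← NNReal.coe_inj, coe_expDiv, coe_expDiv, abs_sub_comm]

theorem expDiv_lt_one (s₁ s₂ : ℝ) : expDiv s₁ s₂ < 1 := by
  rw [← NNReal.coe_lt_coe, coe_expDiv, NNReal.coe_one]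
  exact (Real.mul_exp_neg_le_exp_neg_one _).trans_lt (Real.exp_lt_one_iff.2 (by norm_num))

/-- A compact `L` misses some real number, since `ℝ` is not compact, and `expDiv` is below `1`
everywhere. -/
theorem not_infCompact_expDiv : ¬ InfCompact expDiv := fun h => by
  obtain ⟨L, hL, hle⟩ := h 1 {0} isCompact_singleton
  obtain ⟨x, hx⟩ := (ne_univ_iff_exists_notMem L).1 hL.ne_univ
  have hmem : (x, (0 : ℝ)) ∈ Lᶜ ×ˢ ({0} : Set ℝ) := mk_mem_prod hx (mem_singleton 0)
  exact (expDiv_lt_one x 0).not_ge (ENNReal.coe_le_coe.1 (hle.trans (iInf₂_le _ hmem)))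

theorem wassersteinDiv_expDiv_pointMass (k : ℕ) :
    wassersteinDiv expDiv (pointMass (k : ℝ) : Measure ℝ) (pointMass 0 : Measure ℝ)
      = ENNReal.ofReal ((k : ℝ) * Real.exp (-(k : ℝ))) := by
  change wassersteinDiv expDiv (Measure.dirac (k : ℝ)) (Measure.dirac 0) = _
  rw [wassersteinDiv_dirac_dirac, ← ENNReal.ofReal_coe_nnreal]
  rw [coe_expDiv, sub_zero, abs_of_nonneg k.cast_nonneg]

theorem tendsto_wassersteinDiv_expDiv_pointMass :
    Tendsto (fun k : ℕ => wassersteinDiv expDiv (pointMass (k : ℝ) : Measure ℝ)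
      (pointMass 0 : Measure ℝ)) atTop (𝓝 0) := by
  simp only [wassersteinDiv_expDiv_pointMass]
  have h := (Real.tendsto_pow_mul_exp_neg_atTop_nhds_zero 1).comp
    (tendsto_natCast_atTop_atTop (R := ℝ))
  simpa using ENNReal.tendsto_ofReal h

/-- The masses leave each `Iio n`, so a weak limit would vanish on these open sets, which exhaust
`ℝ`. -/
theorem not_tendsto_pointMass_natCast (ν : ProbabilityMeasure ℝ) :
    ¬ Tendsto (fun k : ℕ => pointMass (k : ℝ)) atTop (𝓝 ν) := fun h => by
  have hball : ∀ n : ℕ, (ν : Measure ℝ) (Iio (n : ℝ)) = 0 := fun n => by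
    refine nonpos_iff_eq_zero.1 ((ProbabilityMeasure.le_liminf_measure_open_of_tendsto h
      isOpen_Iio).trans_eq ?_)
    refine Tendsto.liminf_eq (tendsto_const_nhds.congr' ?_)
    filter_upwards [eventually_ge_atTop n] with k hk
    change 0 = Measure.dirac (k : ℝ) (Iio (n : ℝ))
    rw [Measure.dirac_apply' _ measurableSet_Iio, indicator_of_notMem]
    simpa using hk
  have huniv : (⋃ n : ℕ, Iio (n : ℝ)) = univ := by
    ext x
    simpa using exists_nat_gt x
  have h0 : (ν : Measure ℝ) univ = 0 := by
    rw [← huniv]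
    exact measure_iUnion_null hball
  simp at h0

theorem mainTheorem4 :
    -- limits in the Wasserstein divergence are probability measures and weak* limits
    (∀ (S : Type*) [TopologicalSpace S] [PolishSpace S] [MeasurableSpace S] [BorelSpace S]
      (V : S → S → ℝ≥0), IsDivergence V →
      ∀ (μ : ℕ → ProbabilityMeasure S) (θ : Measure S),
        limsup (fun k => wassersteinDiv V (μ k : Measure S) θ) atTop = 0 →
        ∃ hθ : IsProbabilityMeasure θ,
          Tendsto μ atTop (𝓝 (⟨θ, hθ⟩ : ProbabilityMeasure S))) ∧
    -- inf-compactness cannot be dropped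
    (IsPreDivergence expDiv ∧ ¬ InfCompact expDiv ∧
      (∀ k : ℕ, wassersteinDiv expDiv (pointMass (k : ℝ) : Measure ℝ) (pointMass 0 : Measure ℝ)
        = ENNReal.ofReal ((k : ℝ) * Real.exp (-(k : ℝ)))) ∧
      limsup (fun k : ℕ => wassersteinDiv expDiv (pointMass (k : ℝ) : Measure ℝ)
        (pointMass 0 : Measure ℝ)) atTop = 0 ∧
      ∀ ν : ProbabilityMeasure ℝ, ¬ Tendsto (fun k : ℕ => pointMass (k : ℝ)) atTop (𝓝 ν)) := by
  exact ⟨fun S _ _ _ _ V hV μ θ h => hV.exists_tendsto_of_tendsto_wassersteinDiv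
      (tendsto_zero_of_limsup_eq_zero h),
    isPreDivergence_expDiv, not_infCompact_expDiv, wassersteinDiv_expDiv_pointMass,
    tendsto_wassersteinDiv_expDiv_pointMass.limsup_eq, not_tendsto_pointMass_natCast⟩
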